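/- For $f,g\in\omega^\omega$ write $f\le^* g$ if $f(n)\le g(n)$ for all but finitely many $n$. Let $\mathfrak b$ be the least cardinality of a family $\mathcal F\subseteq\omega^\omega$ for which there is no $g\in\omega^\omega$ with $f\le^* g$ for all $f\in\mathcal F$; let $\mathfrak d$ be the least cardinality of a family $\mathcal F\subseteq\omega^\omega$ such that every $f\in\omega^\omega$ satisfies $f\le^* g$ for some $g\in\mathcal F$; and let $\mathrm{cov}(\mathcal M)$ be the least cardinality of a family of nowhere dense sets whose union is $\omega^\omega$ (with the product topology, $\omega$ discrete). A topological space $X$ is productively Lindelöf if $X\times Y$ is Lindelöf for every Lindelöf space $Y$. If $\mathfrak b=\aleph_1$ or $\mathfrak d=\mathrm{cov}(\mathcal M)$, then every productively Lindelöf completely metrizable space is $\sigma$-compact. -/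

import Mathlib

universe u

/-- A space `X` is productively Lindelöf if `X × Y` is Lindelöf for every Lindelöf space `Y`
(no separation axiom is imposed on `Y`). -/
def ProductivelyLindelof (X : Type u) [TopologicalSpace X] : Prop :=
  ∀ (Y : Type u) [TopologicalSpace Y], LindelofSpace Y → LindelofSpace (X × Y)

/-- Eventual domination on `ℕ → ℕ`: `f n ≤ g n` for all but finitely many `n`. -/
def EventuallyDominatedBy (f g : ℕ → ℕ) : Prop :=
  {n : ℕ | ¬ f n ≤ g n}.Finite

/-- The bounding number `𝔟`: the least cardinality of a family in `ℕ → ℕ` with no upper bound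
for eventual domination. -/
noncomputable def boundingNumber : Cardinal.{0} :=
  sInf {κ | ∃ F : Set (ℕ → ℕ), Cardinal.mk F = κ ∧
    ¬ ∃ g : ℕ → ℕ, ∀ f ∈ F, EventuallyDominatedBy f g}

/-- The dominating number `𝔡`: the least cardinality of a family in `ℕ → ℕ` that is cofinal
for eventual domination. -/
noncomputable def dominatingNumber : Cardinal.{0} :=
  sInf {κ | ∃ F : Set (ℕ → ℕ), Cardinal.mk F = κ ∧
    ∀ f : ℕ → ℕ, ∃ g ∈ F, EventuallyDominatedBy f g}

/-- `cov(ℳ)`: the least cardinality of a family of nowhere dense sets whose union is the whole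
Baire space `ℕ → ℕ` (product topology, `ℕ` discrete). -/
noncomputable def covMeager : Cardinal.{0} :=
  sInf {κ | ∃ N : Set (Set (ℕ → ℕ)), Cardinal.mk N = κ ∧
    (∀ A ∈ N, IsNowhereDense A) ∧ ⋃₀ N = Set.univ}

/-! A productively Lindelöf space is Lindelöf. If it is completely metrizable but not σ-compact,
Hurewicz's theorem puts a closed copy of `ℕ → ℕ` in it, so a Michael space (a Lindelöf `Y` with `(ℕ
→ ℕ) × Y` not Lindelöf) gives a contradiction.

Moore's construction gets `Y` from an increasing well-ordered sequence of sets, proper before the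
last stage, exhausting `ℕ → ℕ`, such that a compact set covered at a stage of uncountable cofinality
is covered earlier. If `𝔟 = ℵ₁`, index an unbounded family by `ω₁` and let a stage collect the
functions failing to bound some earlier member; stages below the top have countable initial
segments. If `𝔡 = cov(ℳ)`, let a stage collect the functions dominated by an earlier member of a
dominating family; Baire category below `cov(ℳ)` gives the compactness condition. -/

/-! ### Closed copies of the Baire space. -/

open Set Filter Topology Metric PiNat in
theorem isClosedEmbedding_of_separated {X : Type*} [MetricSpace X] {f : (ℕ → ℕ) → X}
    (hf : Continuous f)
    (hsep : ∀ (x : ℕ → ℕ) (n : ℕ), ∃ ε > 0, ∀ y ∈ cylinder x n, ∀ z ∈ cylinder x n,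
      y n ≠ z n → ε ≤ dist (f y) (f z)) :
    IsClosedEmbedding f := by
  have hinj : Function.Injective f := by
    intro x y hxy
    by_contra hne
    obtain ⟨ε, hε, h⟩ := hsep x (firstDiff x y)
    have := h x (self_mem_cylinder _ _) y
      ((mem_cylinder_comm _ _ _).1 (mem_cylinder_firstDiff x y)) (apply_firstDiff_ne hne)
    rw [hxy, dist_self] at this
    linarith
  have hprop : IsProperMap f := by
    rw [isProperMap_iff_ultrafilter]
    refine ⟨hf, fun 𝒰 p hp => ?_⟩
    -- Points near `p` in the image cannot come from two children of one cylinder, so the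
    -- ultrafilter picks a digit at every level; these digits form its limit.
    have hcyl : ∀ n, ∃ s, cylinder s n ∈ 𝒰 := by
      intro n
      induction n with
      | zero => exact ⟨0, by rw [cylinder_zero]; exact Filter.univ_mem⟩
      | succ n ih =>
        obtain ⟨s, hs⟩ := ih
        obtain ⟨ε, hε, h⟩ := hsep s n
        have hb : f ⁻¹' ball p (ε / 2) ∈ 𝒰 := hp (ball_mem_nhds p (half_pos hε))
        have hi := inter_mem hs hb
        obtain ⟨w, hws, hwb⟩ := 𝒰.nonempty_of_mem hi
        refine ⟨w, mem_of_superset hi ?_⟩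
        rintro v ⟨hvs, hvb⟩
        rw [mem_cylinder_iff] at hvs hws ⊢
        intro i hi
        rcases Nat.lt_succ_iff_lt_or_eq.1 hi with hi | rfl
        · rw [hvs i hi, hws i hi]
        · by_contra hne
          have h1 := h v (mem_cylinder_iff.2 hvs) w (mem_cylinder_iff.2 hws) hne
          have h2 := dist_triangle_right (f v) (f w) p
          simp only [mem_preimage, mem_ball] at hvb hwb
          linarith
    choose s hs using hcyl
    have hlim : (𝒰 : Filter (ℕ → ℕ)) ≤ 𝓝 (fun n => s (n + 1) n) := by
      refine tendsto_id'.1 (tendsto_pi_nhds.2 fun n => ?_)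
      refine tendsto_nhds_of_eventually_eq ?_
      filter_upwards [hs (n + 1)] with v hv
      exact mem_cylinder_iff.1 hv n n.lt_succ_self
    exact ⟨_, tendsto_nhds_unique ((hf.tendsto _).mono_left hlim) hp, hlim⟩
  exact .of_continuous_injective_isClosedMap hf hinj hprop.isClosedMap

-- A ball of half the radius is not totally bounded, so it contains an infinite `ε`-separated
-- sequence; balls of radius at most `ε / 4` around its terms stay `ε / 2` apart.
open Set Metric in
theorem exists_separated_closedBalls {Z : Type*} [PseudoMetricSpace Z]
    (hZ : ∀ (c : Z) (r : ℝ), 0 < r → ¬ TotallyBounded (ball c r)) (c : Z) (r : ℝ) (hr : 0 < r) :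
    ∃ (u : ℕ → Z) (ρ : ℝ), 0 < ρ ∧ ρ ≤ r / 2 ∧ (∀ k, closedBall (u k) ρ ⊆ closedBall c r) ∧
      ∃ ε > 0, ∀ i j, i ≠ j → ∀ a ∈ closedBall (u i) ρ, ∀ b ∈ closedBall (u j) ρ, ε ≤ dist a b := by
  have h := hZ c (r / 2) (half_pos hr)
  rw [Metric.totallyBounded_iff] at h
  push Not at h
  obtain ⟨ε, hε, h⟩ := h
  obtain ⟨u, hu, hsep⟩ := exists_seq_of_forall_finset_exists (fun x => x ∈ ball c (r / 2))
    (fun x y => ε ≤ dist x y) (by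
      intro s _
      obtain ⟨y, hy, hys⟩ := not_subset.1 (h s s.finite_toSet)
      refine ⟨y, hy, fun x hx => ?_⟩
      by_contra hlt
      exact hys (mem_biUnion hx (by rw [mem_ball, dist_comm]; exact not_le.1 hlt)))
  have hsep' : ∀ i j, i ≠ j → ε ≤ dist (u i) (u j) := by
    intro i j hij
    rcases hij.lt_or_gt with hij | hij
    · exact hsep i j hij
    · rw [dist_comm]; exact hsep j i hij
  refine ⟨u, min (ε / 4) (r / 2), lt_min (by linarith) (by linarith), min_le_right _ _,
    fun k => ?_, ε / 2, by linarith, fun i j hij a ha b hb => ?_⟩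
  · refine closedBall_subset_closedBall' ?_
    have := mem_ball.1 (hu k)
    have := min_le_right (ε / 4) (r / 2)
    linarith
  · have h1 := hsep' i j hij
    have h2 := min_le_left (ε / 4) (r / 2)
    have h3 := dist_triangle4_left (u i) (u j) a b
    rw [mem_closedBall] at ha hb
    have := dist_triangle4 (u i) a b (u j)
    rw [dist_comm (u i) a] at this
    linarith

-- Iterating the separated balls gives a Cantor scheme. Completeness makes every branch converge,
-- and the gap between siblings makes the induced map a closed embedding.
open Set Metric PiNat Topology Filter in
theorem exists_isClosedEmbedding_of_not_totallyBounded_ball {Z : Type*} [MetricSpace Z]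
    [CompleteSpace Z] [Nonempty Z]
    (hZ : ∀ (c : Z) (r : ℝ), 0 < r → ¬ TotallyBounded (ball c r)) :
    ∃ f : (ℕ → ℕ) → Z, IsClosedEmbedding f := by
  choose u ρ hρ hρr hsub hsep using fun c r hr => exists_separated_closedBalls hZ c r hr
  let node : List ℕ → Z × {r : ℝ // 0 < r} := fun l =>
    List.rec (Classical.arbitrary Z, ⟨1, one_pos⟩)
      (fun k _ q => (u q.1 q.2.1 q.2.2 k, ⟨ρ q.1 q.2.1 q.2.2, hρ _ _ _⟩)) l
  let A : List ℕ → Set Z := fun l => closedBall (node l).1 (node l).2.1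
  have hanti : CantorScheme.ClosureAntitone A :=
    CantorScheme.Antitone.closureAntitone (fun l k => hsub _ _ _ k) (fun l => isClosed_closedBall)
  have hrad : ∀ (x : ℕ → ℕ) n, (node (res x n)).2.1 ≤ (1 / 2) ^ n := by
    intro x n
    induction n with
    | zero => exact (pow_zero (1 / 2 : ℝ)).ge
    | succ n ih =>
      refine (hρr _ _ (node (res x n)).2.2).trans ?_
      rw [pow_succ]
      linarith
  have hdiam : CantorScheme.VanishingDiam A := by
    intro x
    have hlim : Tendsto (fun n : ℕ => ENNReal.ofReal (2 * (1 / 2) ^ n)) atTop (𝓝 0) := by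
      have := (tendsto_pow_atTop_nhds_zero_of_lt_one (r := (1 / 2 : ℝ)) (by norm_num)
        (by norm_num)).const_mul 2
      simpa using ENNReal.tendsto_ofReal this
    refine tendsto_of_tendsto_of_tendsto_of_le_of_le tendsto_const_nhds hlim
      (fun _ => zero_le) (fun n => ?_)
    refine Metric.ediam_le fun y hy z hz => ?_
    rw [edist_dist]
    refine ENNReal.ofReal_le_ofReal ?_
    have h1 := dist_triangle_right y z (node (res x n)).1
    have h2 := hrad x n
    have h3 := mem_closedBall.1 hy
    have h4 := mem_closedBall.1 hz
    linarith
  have htot : (CantorScheme.inducedMap A).1 = univ :=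
    hanti.map_of_vanishingDiam hdiam fun l => nonempty_closedBall.2 (node l).2.2.le
  let e : (ℕ → ℕ) → (CantorScheme.inducedMap A).1 := fun x => ⟨x, htot ▸ mem_univ x⟩
  refine ⟨(CantorScheme.inducedMap A).2 ∘ e, isClosedEmbedding_of_separated
    (hdiam.map_continuous.comp (continuous_id.subtype_mk _)) fun x n => ?_⟩
  obtain ⟨ε, hε, h⟩ := hsep (node (res x n)).1 (node (res x n)).2.1 (node (res x n)).2.2
  have key : ∀ y ∈ cylinder x n, (CantorScheme.inducedMap A).2 (e y) ∈ A (y n :: res x n) := by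
    intro y hy
    rw [cylinder_eq_res, mem_ofPred_eq] at hy
    rw [← hy, ← res_succ]
    exact CantorScheme.map_mem (A := A) (e y) (n + 1)
  exact ⟨ε, hε, fun y hy z hz hyz => h _ _ hyz _ (key y hy) _ (key z hz)⟩

open Set Metric Topology TopologicalSpace in
/-- Hurewicz: a Lindelöf completely metrizable space that is not `σ`-compact contains a closed
copy of the Baire space. -/
theorem exists_isClosedEmbedding_of_not_sigmaCompact (X : Type*) [TopologicalSpace X]
    [IsCompletelyMetrizableSpace X] [LindelofSpace X] (hX : ¬ SigmaCompactSpace X) :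
    ∃ f : (ℕ → ℕ) → X, IsClosedEmbedding f := by
  let _ := upgradeIsCompletelyMetrizable X
  have : SecondCountableTopology X := inferInstance
  let W : Set X := {x | ∃ U ∈ 𝓝 x, ∃ T, IsSigmaCompact T ∧ U ⊆ T}
  have hWo : IsOpen W := by
    rw [isOpen_iff_mem_nhds]
    rintro x ⟨U, hU, T, hT, hUT⟩
    filter_upwards [eventually_mem_nhds_iff.2 hU] with y hy
    exact ⟨U, hy, T, hT, hUT⟩
  obtain ⟨T, hT, hWT⟩ : ∃ T, IsSigmaCompact T ∧ W ⊆ T := by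
    choose! U hU T hT hUT using fun x (hx : x ∈ W) => hx
    obtain ⟨t, htc, htW, ht⟩ :=
      (HereditarilyLindelofSpace.isLindelof W).elim_nhds_subcover U hU
    exact ⟨⋃ x ∈ t, T x, isSigmaCompact_biUnion htc fun x hx => hT x (htW x hx),
      ht.trans (iUnion₂_mono fun x hx => hUT x (htW x hx))⟩
  have hne : Nonempty ↥Wᶜ := by
    by_contra hemp
    rw [nonempty_coe_sort, not_nonempty_iff_eq_empty, compl_empty_iff] at hemp
    rw [hemp, univ_subset_iff] at hWT
    exact hX (isSigmaCompact_univ_iff.1 (hWT ▸ hT))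
  have : CompleteSpace ↥Wᶜ := hWo.isClosed_compl.completeSpace_coe
  obtain ⟨f, hf⟩ := exists_isClosedEmbedding_of_not_totallyBounded_ball (Z := ↥Wᶜ) (by
    -- Otherwise the compact closure of this ball, together with `T`, would be a σ-compact
    -- neighbourhood of `c` in `X`, putting `c` in `W`.
    intro c r hr htb
    refine c.2 ⟨ball c.1 r, ball_mem_nhds _ hr,
      (Subtype.val '' closure (ball c r)) ∪ T, ?_, ?_⟩
    · have hc : IsCompact (closure (ball c r)) :=
        htb.closure.isCompact_of_isClosed isClosed_closure
      rw [union_eq_iUnion]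
      exact isSigmaCompact_iUnion _ fun b => by
        cases b
        · exact hT
        · exact (hc.image continuous_subtype_val).isSigmaCompact
    · intro y hy
      by_cases hyW : y ∈ W
      · exact Or.inr (hWT hyW)
      · exact Or.inl ⟨⟨y, hyW⟩, subset_closure hy, rfl⟩)
  exact ⟨_, hWo.isClosed_compl.isClosedEmbedding_subtypeVal.comp hf⟩

/-! ### Baire category below `cov(ℳ)`. -/

open Set Topology PiNat in
/-- A nonempty closed subset of the Baire space is a continuous open image of it. -/
theorem exists_open_map_onto_of_isClosed {L : Set (ℕ → ℕ)} (hL : IsClosed L) (hne : L.Nonempty) :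
    ∃ φ : (ℕ → ℕ) → (ℕ → ℕ), Continuous φ ∧ (∀ x, φ x ∈ L) ∧
      ∀ x n, ∀ y ∈ L, y ∈ cylinder (φ x) n → ∃ x' ∈ cylinder x n, φ x' = y := by
  have hstep : ∀ (z : L) (n k : ℕ), ∃ w : L, w.1 ∈ cylinder z.1 n ∧
      ((∃ v ∈ L, v ∈ cylinder z.1 n ∧ v n = k) → w.1 n = k) := by
    intro z n k
    by_cases h : ∃ v ∈ L, v ∈ cylinder z.1 n ∧ v n = k
    · obtain ⟨v, hv, hvz, hvk⟩ := h
      exact ⟨⟨v, hv⟩, hvz, fun _ => hvk⟩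
    · exact ⟨z, self_mem_cylinder _ _, fun h' => absurd h' h⟩
  choose step hstep_mem hstep_eq using hstep
  -- Follow the digits of `x` whenever `L` allows; otherwise keep the current point of `L`.
  let z : (ℕ → ℕ) → ℕ → L := fun x n => Nat.rec ⟨hne.some, hne.some_mem⟩
    (fun n w => step w n (x n)) n
  let φ : (ℕ → ℕ) → (ℕ → ℕ) := fun x n => (z x (n + 1)).1 n
  have hzs : ∀ x n, z x (n + 1) = step (z x n) n (x n) := fun _ _ => rfl
  have hzφ : ∀ x n, (z x n).1 ∈ cylinder (φ x) n := by
    intro x n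
    induction n with
    | zero => simp
    | succ n ih =>
      rw [mem_cylinder_iff] at ih ⊢
      intro i hi
      rcases Nat.lt_succ_iff_lt_or_eq.1 hi with hi | rfl
      · rw [hzs, mem_cylinder_iff.1 (hstep_mem _ _ _) i hi, ih i hi]
      · rfl
  have hzcongr : ∀ x x' n, x' ∈ cylinder x n → z x' n = z x n := by
    intro x x' n h
    induction n with
    | zero => rfl
    | succ n ih =>
      rw [hzs, hzs, ih (cylinder_anti x n.le_succ h), mem_cylinder_iff.1 h n n.lt_succ_self]
  have hcont : Continuous φ := by
    refine continuous_pi fun n => (IsLocallyConstant.iff_eventually_eq _).2 (fun x => ?_)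
      |>.continuous
    filter_upwards [(isOpen_cylinder (fun _ => ℕ) x (n + 1)).mem_nhds (self_mem_cylinder _ _)]
      with x' hx'
    simp only [φ, hzcongr x x' _ hx']
  refine ⟨φ, hcont, fun x => ?_, fun x n y hy hyx => ?_⟩
  · refine hL.mem_of_tendsto (f := fun n => (z x n).1) (b := Filter.atTop) ?_
      (Filter.Eventually.of_forall fun n => (z x n).2)
    refine tendsto_pi_nhds.2 fun i => tendsto_nhds_of_eventually_eq ?_
    filter_upwards [Filter.eventually_gt_atTop i] with n hn
    exact mem_cylinder_iff.1 (hzφ x n) i hn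
  · let x' : ℕ → ℕ := fun i => if i < n then x i else y i
    have hx' : x' ∈ cylinder x n := mem_cylinder_iff.2 fun i hi => if_pos hi
    refine ⟨x', hx', ?_⟩
    have hfirst : ∀ i < n, φ x' i = φ x i := by
      intro i hi
      simp only [φ, hzcongr x x' (i + 1) (cylinder_anti x hi hx')]
    funext i
    induction i using Nat.strong_induction_on with
    | _ i ih =>
      rcases lt_or_ge i n with hi | hi
      · rw [hfirst i hi, mem_cylinder_iff.1 hyx i hi]
      · have hxi : x' i = y i := if_neg hi.not_gt
        simp only [φ, hzs, hxi]
        refine hstep_eq _ _ _ ⟨y, hy, mem_cylinder_iff.2 fun j hj => ?_, rfl⟩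
        rw [← ih j hj, mem_cylinder_iff.1 (hzφ x' i) j hj]

open Set Topology PiNat in
/-- The Baire category theorem below `cov(ℳ)`, for closed subsets of the Baire space. -/
theorem exists_relatively_open_subset_of_lt_covMeager {ι : Type} (hι : Cardinal.mk ι < covMeager)
    {L : Set (ℕ → ℕ)} (hL : IsClosed L) (hne : L.Nonempty) (A : ι → Set (ℕ → ℕ))
    (hA : ∀ i, IsClosed (A i)) (hLA : L ⊆ ⋃ i, A i) :
    ∃ i, ∃ U, IsOpen U ∧ (L ∩ U).Nonempty ∧ L ∩ U ⊆ A i := by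
  obtain ⟨φ, hφ, hφL, hφo⟩ := exists_open_map_onto_of_isClosed hL hne
  obtain ⟨i, hi⟩ : ∃ i, ¬ IsNowhereDense (φ ⁻¹' A i) := by
    by_contra! hnd
    refine (Cardinal.mk_range_le (f := fun i => φ ⁻¹' A i)).not_gt (hι.trans_le ?_)
    refine csInf_le' ⟨_, rfl, by rintro _ ⟨i, rfl⟩; exact hnd i, ?_⟩
    refine eq_univ_of_forall fun x => ?_
    obtain ⟨i, hi⟩ := mem_iUnion.1 (hLA (hφL x))
    exact ⟨_, ⟨i, rfl⟩, hi⟩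
  rw [((hA i).preimage hφ).isNowhereDense_iff] at hi
  obtain ⟨x, hx⟩ := nonempty_iff_ne_empty.2 hi
  obtain ⟨_, ⟨s, n, rfl⟩, hxs, hsub⟩ :=
    (isTopologicalBasis_cylinders fun _ => ℕ).mem_nhds_iff.1 (mem_interior_iff_mem_nhds.1 hx)
  rw [mem_cylinder_iff_eq] at hxs
  refine ⟨i, cylinder (φ x) n, isOpen_cylinder _ _ _, ⟨φ x, hφL x, self_mem_cylinder _ _⟩, ?_⟩
  rintro y ⟨hyL, hy⟩
  obtain ⟨x', hx', rfl⟩ := hφo x n y hyL hy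
  exact hsub (hxs ▸ hx')

/-! ### Michael spaces from increasing sequences. -/

/-- Every countable set of elements below `δ` has a strict upper bound below `δ`. -/
def CountablyBoundedBelow {J : Type*} [LinearOrder J] (δ : J) : Prop :=
  ∀ A : Set J, A.Countable → (∀ a ∈ A, a < δ) → ∃ b < δ, ∀ a ∈ A, a < b

/-- The inclusion of the Baire space into the compact space `ℕ → ℕ∞`. -/
def baireToCompact (x : ℕ → ℕ) : ℕ → ℕ∞ := fun n => x n

open Topology in
theorem isEmbedding_baireToCompact : IsEmbedding baireToCompact :=
  IsEmbedding.piMap fun _ => ENat.isEmbedding_natCast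

-- Induction on `δ`. At uncountable cofinality, countably many boxes cover the fibre over `δ` and a
-- tail below it: the uncovered part of `ℕ → ℕ∞` is compact and inside `S δ`, hence inside an
-- earlier `S b'`. Otherwise the fibre and countably many earlier pieces suffice.
open Set Topology in
theorem isLindelof_michael {J : Type*} [LinearOrder J] [WellFoundedLT J] [TopologicalSpace J]
    [OrderTopology J] {S : J → Set (ℕ → ℕ)} (hmono : Monotone S)
    (hK : ∀ δ, CountablyBoundedBelow δ → ∀ K, IsCompact K → K ⊆ S δ → ∃ β < δ, K ⊆ S β) (δ : J) :
    IsLindelof {q : J × (ℕ → ℕ∞) | q.2 ∉ baireToCompact '' S q.1 ∧ q.1 ≤ δ} := by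
  induction δ using WellFoundedLT.induction with
  | ind δ ih =>
  have hfib := HereditarilyLindelofSpace.isLindelof (baireToCompact '' S δ)ᶜ
  by_cases hδ : CountablyBoundedBelow δ
  · refine isLindelof_of_countable_subcover fun {ι} U hU hcov => ?_
    rcases isEmpty_or_nonempty ι with hι | hι
    · exact ⟨∅, countable_empty, hcov.trans (by simp)⟩
    have : Nonempty J := ⟨δ⟩
    have hloc : ∀ z ∈ (baireToCompact '' S δ)ᶜ, ∃ i, ∃ β < δ, ∃ V ∈ 𝓝 z,
        Ioc β δ ×ˢ V ⊆ U i := by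
      intro z hz
      obtain ⟨i, hi⟩ := mem_iUnion.1 (@hcov (δ, z) ⟨hz, le_rfl⟩)
      obtain ⟨B, hB, V, hV, hBV⟩ := mem_nhds_prod_iff.1 ((hU i).mem_nhds hi)
      obtain ⟨b, hb, -⟩ := hδ ∅ countable_empty (by simp)
      obtain ⟨β, hβ, hsub⟩ := exists_Ioc_subset_of_mem_nhds hB ⟨b, hb⟩
      exact ⟨i, β, hβ, V, hV, (prod_mono hsub subset_rfl).trans hBV⟩
    choose! i β hβ V hV hsub using hloc
    obtain ⟨t, htc, ht, hcovt⟩ := hfib.elim_nhds_subcover (fun z => interior (V z))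
      fun z hz => interior_mem_nhds.2 (hV z hz)
    obtain ⟨b, hb, hbt⟩ := hδ (β '' t) (htc.image β) (by
      rintro _ ⟨z, hz, rfl⟩
      exact hβ z (ht z hz))
    have hO : IsClosed (⋃ z ∈ t, interior (V z))ᶜ :=
      (isOpen_biUnion fun _ _ => isOpen_interior).isClosed_compl
    have hOS : (⋃ z ∈ t, interior (V z))ᶜ ⊆ baireToCompact '' S δ := compl_subset_comm.1 hcovt
    obtain ⟨b', hb', hKb'⟩ := hK δ hδ (baireToCompact ⁻¹' (⋃ z ∈ t, interior (V z))ᶜ)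
      (isEmbedding_baireToCompact.isInducing.isCompact_preimage' hO.isCompact
        (hOS.trans (image_subset_range _ _)))
      (fun x hx => by
        obtain ⟨x', hx', he⟩ := hOS hx
        rwa [← isEmbedding_baireToCompact.injective he])
    obtain ⟨r, hr, hcovr⟩ := (ih (max b b') (max_lt hb hb')).elim_countable_subcover U hU
      fun q hq => hcov ⟨hq.1, hq.2.trans (max_lt hb hb').le⟩
    refine ⟨r ∪ i '' t, hr.union (htc.image i), ?_⟩
    rintro q ⟨hqS, hqδ⟩
    rcases le_or_gt q.1 (max b b') with hq | hq
    · exact biUnion_mono subset_union_left (fun _ _ => subset_rfl) (hcovr ⟨hqS, hq⟩)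
    · have hqO : q.2 ∈ ⋃ z ∈ t, interior (V z) := by
        by_contra hqO
        obtain ⟨x, -, hxq⟩ := hOS hqO
        refine hqS ⟨x, hmono ((le_max_right b b').trans hq.le) (hKb' ?_), hxq⟩
        rw [mem_preimage, hxq]
        exact hqO
      obtain ⟨z, hz, hqz⟩ := mem_iUnion₂.1 hqO
      refine mem_biUnion (Or.inr (mem_image_of_mem i hz)) (hsub z (ht z hz) ⟨⟨?_, hqδ⟩,
        interior_subset hqz⟩)
      exact (hbt _ (mem_image_of_mem β hz)).trans ((le_max_left b b').trans_lt hq)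
  · unfold CountablyBoundedBelow at hδ
    push Not at hδ
    obtain ⟨A, hA, hAδ, hcof⟩ := hδ
    have hfib' : IsLindelof (Prod.mk δ '' (baireToCompact '' S δ)ᶜ) :=
      hfib.image (by fun_prop)
    convert hfib'.union (hA.isLindelof_biUnion fun a ha => ih a (hAδ a ha)) using 1
    ext ⟨a, z⟩
    constructor
    · rintro ⟨hz, ha⟩
      rcases ha.lt_or_eq with ha | rfl
      · obtain ⟨a', ha', h⟩ := hcof a ha
        exact Or.inr (mem_biUnion ha' ⟨hz, h⟩)
      · exact Or.inl ⟨z, hz, rfl⟩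
    · rintro (⟨z, hz, h⟩ | h)
      · obtain ⟨rfl, rfl⟩ := Prod.mk.inj h
        exact ⟨hz, le_rfl⟩
      · obtain ⟨a', ha', hz, h⟩ := mem_iUnion₂.1 h
        exact ⟨hz, le_trans h (hAδ a' ha').le⟩

open Set Topology in
/-- Moore's construction of a Michael space from a suitable increasing sequence of subsets of
the Baire space. -/
theorem exists_michael_space {J : Type} [LinearOrder J] [WellFoundedLT J] [OrderTop J]
    {S : J → Set (ℕ → ℕ)} (hmono : Monotone S) (htop : S ⊤ = univ) (hne : ∀ a < ⊤, S a ≠ univ)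
    (hcof : CountablyBoundedBelow (⊤ : J))
    (hK : ∀ δ, CountablyBoundedBelow δ → ∀ K, IsCompact K → K ⊆ S δ → ∃ β < δ, K ⊆ S β) :
    ∃ (Y : Type) (_ : TopologicalSpace Y), LindelofSpace Y ∧ ¬ LindelofSpace ((ℕ → ℕ) × Y) := by
  let _ : TopologicalSpace J := Preorder.topology J
  have : OrderTopology J := ⟨rfl⟩
  let Y : Set (J × (ℕ → ℕ∞)) := {q | q.2 ∉ baireToCompact '' S q.1}
  have hY : IsLindelof Y := by
    simpa only [le_top, and_true] using isLindelof_michael hmono hK ⊤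
  refine ⟨Y, inferInstance, isLindelof_iff_lindelofSpace.1 hY, fun hL => ?_⟩
  -- This closed set avoids height `⊤` yet reaches every height below it, so the cover by initial
  -- segments has no countable subcover.
  let F : Set ((ℕ → ℕ) × Y) := {p | baireToCompact p.1 = p.2.1.2}
  have hF : IsClosed F := isClosed_eq (isEmbedding_baireToCompact.continuous.comp continuous_fst)
    (by fun_prop)
  obtain ⟨t, htc, ht⟩ := hF.isLindelof.elim_countable_subcover
    (fun b : Iio (⊤ : J) => {p : (ℕ → ℕ) × Y | p.2.1.1 < b.1})
    (fun b => isOpen_Iio.preimage (f := fun p : (ℕ → ℕ) × Y => p.2.1.1) (by fun_prop)) (by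
      rintro ⟨x, ⟨⟨a, z⟩, hz⟩⟩ hp
      have ha : a < ⊤ := by
        refine lt_top_iff_ne_top.2 ?_
        rintro rfl
        exact hz ⟨x, htop ▸ mem_univ x, hp⟩
      obtain ⟨b, hb, hab⟩ := hcof {a} (countable_singleton a) (by simpa using ha)
      exact mem_iUnion.2 ⟨⟨b, hb⟩, hab a rfl⟩)
  obtain ⟨b, hb, hbt⟩ := hcof (Subtype.val '' t) (htc.image _) (by
    rintro _ ⟨a, -, rfl⟩
    exact a.2)
  obtain ⟨x, hx⟩ := (ne_univ_iff_exists_notMem _).1 (hne b hb)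
  have hxY : (b, baireToCompact x) ∈ Y := by
    rintro ⟨x', hx', he⟩
    exact hx (isEmbedding_baireToCompact.injective he ▸ hx')
  obtain ⟨a, ha, hba⟩ := mem_iUnion₂.1 (ht (show (x, (⟨_, hxY⟩ : Y)) ∈ F from rfl))
  exact lt_asymm hba (hbt _ (mem_image_of_mem _ ha))

-- Stage `a` of the sequence is the set of points related to some index below `a`; the adjoined top
-- is the stage where everything is covered.
open Set in
theorem exists_michael_space_of_relation {I : Type} [LinearOrder I] [WellFoundedLT I]
    (P : I → (ℕ → ℕ) → Prop) (hcof : ∀ A : Set I, A.Countable → ∃ b, ∀ a ∈ A, a < b)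
    (hne : ∀ i, ∃ x, ∀ j < i, ¬ P j x) (htop : ∀ K, IsCompact K → ∃ i, ∀ x ∈ K, P i x)
    (hK : ∀ i : I, CountablyBoundedBelow i → ∀ K, IsCompact K →
      (∀ x ∈ K, ∃ j < i, P j x) → ∃ k < i, ∀ x ∈ K, ∃ j < k, P j x) :
    ∃ (Y : Type) (_ : TopologicalSpace Y), LindelofSpace Y ∧ ¬ LindelofSpace ((ℕ → ℕ) × Y) := by
  refine exists_michael_space (J := WithTop I)
    (S := fun a => {x | ∃ j : I, (j : WithTop I) < a ∧ P j x}) ?_ ?_ ?_ ?_ ?_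
  · rintro a b hab x ⟨j, hj, hx⟩
    exact ⟨j, hj.trans_le hab, hx⟩
  · refine eq_univ_of_forall fun x => ?_
    obtain ⟨i, hi⟩ := htop {x} isCompact_singleton
    exact ⟨i, WithTop.coe_lt_top i, hi x rfl⟩
  · intro a ha
    lift a to I using ha.ne
    obtain ⟨x, hx⟩ := hne a
    refine (ne_univ_iff_exists_notMem _).2 ⟨x, ?_⟩
    rintro ⟨j, hj, hjx⟩
    exact hx j (WithTop.coe_lt_coe.1 hj) hjx
  · intro A hA hAt
    obtain ⟨b, hb⟩ := hcof ((↑) ⁻¹' A) (hA.preimage WithTop.coe_injective)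
    refine ⟨b, WithTop.coe_lt_top b, fun a ha => ?_⟩
    lift a to I using (hAt a ha).ne
    exact WithTop.coe_lt_coe.2 (hb a ha)
  · intro δ hδ K hKc hKS
    induction δ using WithTop.recTopCoe with
    | top =>
      obtain ⟨i, hi⟩ := htop K hKc
      obtain ⟨b, hb⟩ := hcof {i} (countable_singleton i)
      exact ⟨b, WithTop.coe_lt_top b, fun x hx => ⟨i, WithTop.coe_lt_coe.2 (hb i rfl), hi x hx⟩⟩
    | coe i =>
      obtain ⟨k, hk, h⟩ := hK i (fun A hA hAi => by
        obtain ⟨b, hb, hbA⟩ := hδ ((↑) '' A) (hA.image _) (by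
          rintro _ ⟨a, ha, rfl⟩
          exact WithTop.coe_lt_coe.2 (hAi a ha))
        lift b to I using (hb.trans (WithTop.coe_lt_top i)).ne
        exact ⟨b, WithTop.coe_lt_coe.1 hb, fun a ha =>
          WithTop.coe_lt_coe.1 (hbA a (mem_image_of_mem _ ha))⟩) K hKc (fun x hx => by
        obtain ⟨j, hj, hjx⟩ := hKS hx
        exact ⟨j, WithTop.coe_lt_coe.1 hj, hjx⟩)
      refine ⟨k, WithTop.coe_lt_coe.2 hk, fun x hx => ?_⟩
      obtain ⟨j, hj, hjx⟩ := h x hx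
      exact ⟨j, WithTop.coe_lt_coe.2 hj, hjx⟩

/-! ### Eventual domination and the case `𝔟 = ℵ₁`. -/

theorem EventuallyDominatedBy.trans {f g h : ℕ → ℕ} (hfg : EventuallyDominatedBy f g)
    (hgh : EventuallyDominatedBy g h) : EventuallyDominatedBy f h := by
  refine (Set.Finite.union hfg hgh).subset fun n hn => ?_
  by_contra hc
  simp only [Set.mem_union, Set.mem_ofPred_eq, not_or, not_not] at hc
  exact hn (hc.1.trans hc.2)

theorem EventuallyDominatedBy.of_le {f g : ℕ → ℕ} (h : ∀ n, f n ≤ g n) :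
    EventuallyDominatedBy f g := by
  simp [EventuallyDominatedBy, h]

theorem eventuallyDominatedBy_iff {f g : ℕ → ℕ} :
    EventuallyDominatedBy f g ↔ ∃ n, ∀ m ≥ n, f m ≤ g m := by
  rw [EventuallyDominatedBy, ← Filter.eventually_atTop, ← Nat.cofinite_eq_atTop,
    Filter.eventually_cofinite]

theorem Set.Countable.exists_eventually_bound {F : Set (ℕ → ℕ)} (hF : F.Countable) :
    ∃ g, ∀ f ∈ F, EventuallyDominatedBy f g := by
  rcases F.eq_empty_or_nonempty with rfl | hne
  · exact ⟨0, by simp⟩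
  · obtain ⟨f, rfl⟩ := hF.exists_eq_range hne
    refine ⟨fun m => (Finset.range (m + 1)).sup fun n => f n m, ?_⟩
    rintro _ ⟨n, rfl⟩
    exact eventuallyDominatedBy_iff.2 ⟨n, fun m hm =>
      Finset.le_sup (f := fun n => f n m) (Finset.mem_range.2 (Nat.lt_succ_of_le hm))⟩

theorem IsCompact.exists_pointwise_bound {K : Set (ℕ → ℕ)} (hK : IsCompact K) :
    ∃ g : ℕ → ℕ, ∀ x ∈ K, ∀ n, x n ≤ g n := by
  choose g hg using fun n => (hK.image (continuous_apply n)).bddAbove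
  exact ⟨g, fun x hx n => hg n (Set.mem_image_of_mem _ hx)⟩

open Cardinal Set in
theorem exists_michael_space_of_boundingNumber_eq (h : boundingNumber = aleph 1) :
    ∃ (Y : Type) (_ : TopologicalSpace Y), LindelofSpace Y ∧ ¬ LindelofSpace ((ℕ → ℕ) × Y) := by
  have hmem := csInf_mem (s := {κ | ∃ F : Set (ℕ → ℕ), #F = κ ∧
    ¬ ∃ g : ℕ → ℕ, ∀ f ∈ F, EventuallyDominatedBy f g}) (by
      by_contra hemp
      rw [not_nonempty_iff_eq_empty] at hemp
      rw [boundingNumber, hemp, Cardinal.sInf_empty] at h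
      exact (aleph_pos 1).ne h)
  obtain ⟨F, hF, hub⟩ := hmem
  change #F = boundingNumber at hF
  rw [h, ← mk_ord_toType (aleph 1)] at hF
  obtain ⟨e⟩ := Cardinal.eq.1 hF.symm
  have hunb : ∀ g, ∃ i, ¬ EventuallyDominatedBy (e i).1 g := by
    intro g
    by_contra! hg
    exact hub ⟨g, fun f hf => by simpa using hg (e.symm ⟨f, hf⟩)⟩
  have hIio : ∀ i : (aleph 1).ord.ToType, (Iio i).Countable := fun i =>
    (countable_iff_lt_aleph_one _).2 (mk_Iio_toType_ord_lt i)
  refine exists_michael_space_of_relation (fun i x => ¬ EventuallyDominatedBy (e i).1 x)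
    ?_ ?_ ?_ ?_
  · intro A hA
    by_contra! hcof
    have huniv : (univ : Set (aleph 1).ord.ToType).Countable := by
      refine (hA.biUnion fun a _ => (hIio a).insert a).mono fun b _ => ?_
      obtain ⟨a, ha, hba⟩ := hcof b
      exact mem_biUnion ha (hba.eq_or_lt)
    rw [countable_iff_lt_aleph_one, mk_univ, mk_ord_toType] at huniv
    exact lt_irrefl _ huniv
  · intro i
    obtain ⟨g, hg⟩ := ((hIio i).image fun j => (e j).1).exists_eventually_bound
    exact ⟨g, fun j hj => not_not.2 (hg _ (mem_image_of_mem _ hj))⟩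
  · intro K hK
    obtain ⟨g, hg⟩ := hK.exists_pointwise_bound
    obtain ⟨i, hi⟩ := hunb g
    exact ⟨i, fun x hx hix => hi (hix.trans (.of_le (hg x hx)))⟩
  -- Vacuous: the initial segment below `i` is countable, so `hi` would bound it strictly by one of
  -- its own elements.
  · intro i hi
    obtain ⟨b, hb, hbi⟩ := hi (Iio i) (hIio i) (fun _ => id)
    exact absurd (hbi b hb) (lt_irrefl b)

/-! ### The case `𝔡 = cov(ℳ)`. -/

open Cardinal Set in
theorem exists_not_dominated_of_lt_dominatingNumber {F : Set (ℕ → ℕ)}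
    (hF : #F < dominatingNumber) : ∃ x, ∀ f ∈ F, ¬ EventuallyDominatedBy x f := by
  by_contra! hd
  exact hF.not_ge (csInf_le' ⟨F, rfl, hd⟩)

open Cardinal Set in
theorem exists_dominating_family : ∃ F : Set (ℕ → ℕ), #F = dominatingNumber ∧
    ∀ x : ℕ → ℕ, ∃ f ∈ F, EventuallyDominatedBy x f :=
  csInf_mem (s := {κ | ∃ F : Set (ℕ → ℕ), #F = κ ∧
    ∀ f : ℕ → ℕ, ∃ g ∈ F, EventuallyDominatedBy f g})
    ⟨_, univ, rfl, fun f => ⟨f, mem_univ f, .of_le fun _ => le_rfl⟩⟩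

open Cardinal Set in
theorem aleph0_lt_dominatingNumber : ℵ₀ < dominatingNumber := by
  by_contra! hle
  obtain ⟨F, hF, hdom⟩ := exists_dominating_family
  rw [← hF, le_aleph0_iff_set_countable] at hle
  obtain ⟨g, hg⟩ := hle.exists_eventually_bound
  obtain ⟨f, hf, hgf⟩ := hdom (fun n => g n + 1)
  obtain ⟨n, hn⟩ := eventuallyDominatedBy_iff.1 (hgf.trans (hg f hf))
  exact (hn n le_rfl).not_gt (Nat.lt_succ_self _)

open Cardinal Set Topology TopologicalSpace in
/-- If a closed set `K` is covered by fewer than `cov(ℳ)` sets `{x | x ≤* f j}`, indexed by an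
initial segment of uncountable cofinality, then a proper initial segment of them covers `K`. -/
theorem exists_lt_cover_of_lt_covMeager {I : Type} [LinearOrder I] (f : I → ℕ → ℕ) {i : I}
    (hi : CountablyBoundedBelow i) (hcard : #(Iio i × ℕ) < covMeager) {K : Set (ℕ → ℕ)}
    (hK : IsClosed K) (hcov : ∀ x ∈ K, ∃ j < i, EventuallyDominatedBy x (f j)) :
    ∃ k < i, ∀ x ∈ K, ∃ j < k, EventuallyDominatedBy x (f j) := by
  -- Basic open sets where `K` is covered before `i`: there are countably many, so one `b` serves
  -- them all. If they missed part of `K`, category on the remainder would produce another such set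
  -- meeting it.
  let G : Set (Set (ℕ → ℕ)) := {U ∈ countableBasis (ℕ → ℕ) |
    ∃ k < i, ∀ x ∈ K ∩ U, ∃ j < k, EventuallyDominatedBy x (f j)}
  have hG : G.Countable := (countable_countableBasis _).mono fun _ hU => hU.1
  have : Nonempty I := ⟨i⟩
  choose! k hki hk using fun U (hU : U ∈ G) => hU.2
  obtain ⟨b, hb, hbG⟩ := hi (k '' G) (hG.image k) (by
    rintro _ ⟨U, hU, rfl⟩
    exact hki U hU)
  have hbcov : ∀ x ∈ K, x ∈ ⋃₀ G → ∃ j < b, EventuallyDominatedBy x (f j) := by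
    rintro x hx ⟨U, hU, hxU⟩
    obtain ⟨j, hj, hxj⟩ := hk U hU x ⟨hx, hxU⟩
    exact ⟨j, hj.trans (hbG _ (mem_image_of_mem k hU)), hxj⟩
  refine ⟨b, hb, fun x hx => hbcov x hx ?_⟩
  by_contra hxG
  have hGo : IsOpen (⋃₀ G) := isOpen_sUnion fun U hU => isOpen_of_mem_countableBasis hU.1
  obtain ⟨⟨j, n⟩, U, hUo, ⟨y, ⟨hyK, hyG⟩, hyU⟩, hsub⟩ :=
    exists_relatively_open_subset_of_lt_covMeager hcard (hK.inter hGo.isClosed_compl)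
      ⟨x, hx, hxG⟩ (fun p : Iio i × ℕ => {x | ∀ m ≥ p.2, x m ≤ f p.1 m})
      (fun p => by
        simp only [ofPred_forall]
        exact isClosed_iInter fun m => isClosed_iInter fun _ =>
          isClosed_le (continuous_apply m) continuous_const)
      (fun y hy => by
        obtain ⟨j, hj, hyj⟩ := hcov y hy.1
        obtain ⟨n, hn⟩ := eventuallyDominatedBy_iff.1 hyj
        exact mem_iUnion.2 ⟨(⟨j, hj⟩, n), hn⟩)
  obtain ⟨U', hU', hyU', hU'U⟩ :=
    (isBasis_countableBasis (ℕ → ℕ)).exists_subset_of_mem_open hyU hUo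
  obtain ⟨c, hc, hbc⟩ := hi {b, j.1} (by simp) (by simpa using ⟨hb, j.2⟩)
  refine hyG ⟨U', ⟨hU', c, hc, fun z hz => ?_⟩, hyU'⟩
  by_cases hzG : z ∈ ⋃₀ G
  · obtain ⟨l, hl, hzl⟩ := hbcov z hz.1 hzG
    exact ⟨l, hl.trans (hbc b (by simp)), hzl⟩
  · exact ⟨j, hbc j (by simp), eventuallyDominatedBy_iff.2 ⟨n, hsub ⟨⟨hz.1, hzG⟩, hU'U hz.2⟩⟩⟩

open Cardinal Set in
theorem exists_michael_space_of_dominatingNumber_eq (h : dominatingNumber = covMeager) :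
    ∃ (Y : Type) (_ : TopologicalSpace Y), LindelofSpace Y ∧ ¬ LindelofSpace ((ℕ → ℕ) × Y) := by
  obtain ⟨F, hF, hdom⟩ := exists_dominating_family
  obtain ⟨e⟩ := Cardinal.eq.1 ((mk_ord_toType dominatingNumber).trans hF.symm)
  have hdom' : ∀ x, ∃ i, EventuallyDominatedBy x (e i).1 := by
    intro x
    obtain ⟨f, hf, hxf⟩ := hdom x
    exact ⟨e.symm ⟨f, hf⟩, by simpa using hxf⟩
  have hnd : ∀ i, ∃ x, ∀ j < i, ¬ EventuallyDominatedBy x (e j).1 := by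
    intro i
    obtain ⟨x, hx⟩ := exists_not_dominated_of_lt_dominatingNumber
      (F := (fun j => (e j).1) '' Iio i) (mk_image_le.trans_lt (mk_Iio_toType_ord_lt i))
    exact ⟨x, fun j hj => hx _ (mem_image_of_mem _ hj)⟩
  have := Cardinal.noMaxOrder aleph0_lt_dominatingNumber.le
  refine exists_michael_space_of_relation (fun i x => EventuallyDominatedBy x (e i).1) ?_ hnd ?_ ?_
  · intro A hA
    by_contra! hcof
    -- A bound `g` for the countably many `x (s a)` is dominated by a member of index `i ≤ a < s a`,
    -- which `x (s a)` was chosen to escape.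
    choose x hx using hnd
    choose s hs using fun i : dominatingNumber.ord.ToType => exists_gt i
    obtain ⟨g, hg⟩ := (hA.image fun a => x (s a)).exists_eventually_bound
    obtain ⟨i, hi⟩ := hdom' g
    obtain ⟨a, ha, hia⟩ := hcof i
    exact hx (s a) i (hia.trans_lt (hs a)) ((hg _ (mem_image_of_mem _ ha)).trans hi)
  · intro K hK
    obtain ⟨g, hg⟩ := hK.exists_pointwise_bound
    obtain ⟨i, hi⟩ := hdom' g
    exact ⟨i, fun x hx => .trans (.of_le (hg x hx)) hi⟩
  · intro i hi K hK hcov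
    refine exists_lt_cover_of_lt_covMeager (fun j => (e j).1) hi ?_ hK.isClosed hcov
    rw [← h, mk_prod, lift_id, lift_id, mk_nat]
    exact mul_lt_of_lt aleph0_lt_dominatingNumber.le (mk_Iio_toType_ord_lt i)
      aleph0_lt_dominatingNumber

theorem corollary22
    (h : boundingNumber = Cardinal.aleph 1 ∨ dominatingNumber = covMeager)
    (X : Type u) [TopologicalSpace X] [TopologicalSpace.IsCompletelyMetrizableSpace X]
    (hX : ProductivelyLindelof X) :
    SigmaCompactSpace X := by
  have hXL : LindelofSpace X :=
    have := hX PUnit inferInstance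
    .of_continuous_surjective continuous_fst (Prod.fst_surjective (β := PUnit.{u + 1}))
  by_contra hσ
  obtain ⟨f, hf⟩ := exists_isClosedEmbedding_of_not_sigmaCompact X hσ
  obtain ⟨Y, _, hY, hnot⟩ := h.elim exists_michael_space_of_boundingNumber_eq
    exists_michael_space_of_dominatingNumber_eq
  -- The Michael space lives in `Type`, while `hX` tests spaces in universe `u`.
  have hYL : LindelofSpace (ULift.{u} Y) :=
    .of_continuous_surjective continuous_uliftUp ULift.up_surjective
  have := hX (ULift.{u} Y) hYL
  exact hnot (hf.prodMap Homeomorph.ulift.symm.isClosedEmbedding).LindelofSpace
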